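/- Let $\mathcal H_1\cong\mathbb C^{d_1}$ and $\mathcal H_2\cong\mathbb C^{d_2}$ be finite-dimensional Hilbert spaces with $d_1\ge 1$. A channel is a completely positive trace-preserving linear map from operators on $\mathcal H_1$ to operators on $\mathcal H_2$; let $\mathcal O$ be the set of all channels. Let the set of free channels be a union $\mathcal O_{\mathrm F}=\bigcup_k\mathcal O_{\mathrm F_k}$, over an arbitrary index set, of convex sets $\mathcal O_{\mathrm F_k}\subseteq\mathcal O$. The generalized robustness of $\Lambda\in\mathcal O$ is $$R_{\mathcal O_{\mathrm F}}(\Lambda)=\inf\Big\{s\ge 0:\ \tfrac{\Lambda+s\Theta}{1+s}\in\mathcal O_{\mathrm F}\text{ for some }\Theta\in\mathcal O\Big\}\in[0,\infty],\qquad \inf\emptyset=\infty .$$ For a finite ensemble $\{p_i,\eta_i\}_i$ of states $\eta_i$ on $\mathcal H_1\otimes\mathcal H_1$ ($p_i\ge 0$, $\sum_i p_i=1$) and a measurement (POVM) $\{M_i\}_i$ on $\mathcal H_1\otimes\mathcal H_2$ with the same labels, put $$p_{\mathrm{succ}}(\Lambda,\{p_i,\eta_i\}_i,\{M_i\}_i)=\sum_i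 p_i\operatorname{tr}\big[M_i\,(\mathcal I_{\mathcal H_1}\otimes\Lambda)(\eta_i)\big].$$ Theorem. For every channel $\Lambda\in\mathcal O$, $$\inf_k\ \max_{\{p_i,\eta_i\}_i,\{M_i\}_i}\ \frac{p_{\mathrm{succ}}(\Lambda,\{p_i,\eta_i\}_i,\{M_i\}_i)}{\sup_{\Xi\in\mathcal O_{\mathrm F_k}}p_{\mathrm{succ}}(\Xi,\{p_i,\eta_i\}_i,\{M_i\}_i)}\;=\;1+R_{\mathcal O_{\mathrm F}}(\Lambda)$$ as an identity in $[0,\infty]$, where $c/0=\infty$ for $c>0$, $0/0=0$, and a supremum over the empty set is $0$. For every $k$ the maximum over finite ensembles and measurements is attained. If $\mathcal O_{\mathrm F_k}$ is closed and nonempty, the supremum in the denominator is attained for every ensemble and measurement. If $\mathcal O_{\mathrm F}$ is closed and $R_{\mathcal O_{\mathrm F}}(\Lambda)<\infty$, the infimum defining $R_{\mathcal O_{\mathrm F}}(\Lambda)$ is attained. -/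

import Mathlib

open scoped ComplexOrder ENNReal NNReal Kronecker

noncomputable section

namespace ChannelQRT

/-- Linear maps from operators on `ℂ^n` to operators on `ℂ^m`. -/
abbrev SuperOp (n m : Type*) :=
  Matrix n n ℂ →ₗ[ℂ] Matrix m m ℂ

/-- The map `id_a ⊗ Φ`, acting on block matrices by applying `Φ` to every block. -/
def ampliation {n m : Type*} (a : Type*) (Φ : SuperOp n m) : SuperOp (a × n) (a × m) where
  toFun X := Matrix.of fun p q =>
    Φ (Matrix.of fun i j => X (p.1, i) (q.1, j)) p.2 q.2
  map_add' X Y := by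
    ext p q
    exact congrFun (congrFun (Φ.map_add (Matrix.of fun i j => X (p.1, i) (q.1, j))
      (Matrix.of fun i j => Y (p.1, i) (q.1, j))) p.2) q.2
  map_smul' c X := by
    ext p q
    exact congrFun (congrFun (Φ.map_smul c (Matrix.of fun i j => X (p.1, i) (q.1, j))) p.2) q.2

/-- On product operators, `(id_a ⊗ Φ)(A ⊗ B) = A ⊗ Φ(B)`. -/
theorem ampliation_kronecker {n m a : Type*} (Φ : SuperOp n m)
    (A : Matrix a a ℂ) (B : Matrix n n ℂ) :
    ampliation a Φ (A ⊗ₖ B) = A ⊗ₖ (Φ B) := by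
  ext p q
  exact congrFun (congrFun (Φ.map_smul (A p.1 q.1) B) p.2) q.2

/-- Quantum channels: completely positive trace-preserving linear maps. -/
structure IsChannel {n m : Type*} [Fintype n] [Fintype m] (Φ : SuperOp n m) : Prop where
  completelyPositive : ∀ (k : ℕ) (X : Matrix (Fin k × n) (Fin k × n) ℂ),
    X.PosSemidef → (ampliation (Fin k) Φ X).PosSemidef
  tracePreserving : ∀ X : Matrix n n ℂ, (Φ X).trace = X.trace

/-- The Choi operator `∑ i j, |i⟩⟨j| ⊗ Φ(|i⟩⟨j|)`. -/
def choi {n m : Type*} [Fintype n] [DecidableEq n] (Φ : SuperOp n m) :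
    Matrix (n × m) (n × m) ℂ :=
  ∑ i : n, ∑ j : n, Matrix.single i j (1 : ℂ) ⊗ₖ Φ (Matrix.single i j (1 : ℂ))

/-- A set of maps is closed in the (unique Hausdorff vector space) topology of the
finite-dimensional space of linear maps, transported along the Choi isomorphism. -/
def IsClosedSet {n m : Type*} [Fintype n] [DecidableEq n] (F : Set (SuperOp n m)) : Prop :=
  IsClosed (choi '' F)

/-- An ensemble of `N` density operators on `ℂ^n` with their probabilities. -/
structure Ensemble (N : ℕ) (n : Type*) [Fintype n] where
  prob : Fin N → ℝ
  prob_nonneg : ∀ i, 0 ≤ prob i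
  prob_sum : ∑ i, prob i = 1
  state : Fin N → Matrix n n ℂ
  state_posSemidef : ∀ i, (state i).PosSemidef
  state_trace : ∀ i, (state i).trace = 1

/-- A measurement (POVM) on `ℂ^n` with `N` outcomes. -/
structure Measurement (N : ℕ) (n : Type*) [Fintype n] [DecidableEq n] where
  effect : Fin N → Matrix n n ℂ
  effect_posSemidef : ∀ i, (effect i).PosSemidef
  effect_sum : ∑ i, effect i = 1

section Task

variable {n m : Type*} [Fintype n] [DecidableEq n] [Fintype m] [DecidableEq m]

/-- The success probability `∑ i, p_i tr[M_i (id ⊗ Φ)(η_i)]`. -/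
def psucc {N : ℕ} (Φ : SuperOp n m) (E : Ensemble N (n × n)) (M : Measurement N (n × m)) : ℝ :=
  ∑ i, E.prob i * ((M.effect i * ampliation n Φ (E.state i)).trace).re

/-- The best success probability over the channels of `F`. -/
def bestSucc {N : ℕ} (F : Set (SuperOp n m)) (E : Ensemble N (n × n))
    (M : Measurement N (n × m)) : ℝ≥0∞ :=
  ⨆ Ξ ∈ F, ENNReal.ofReal (psucc Ξ E M)

/-- The advantage of `Λ` over `F` in one task, where `c / 0 = ∞` for `c > 0` and `0 / 0 = 0`. -/
def advantage {N : ℕ} (Λ : SuperOp n m) (F : Set (SuperOp n m)) (E : Ensemble N (n × n))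
    (M : Measurement N (n × m)) : ℝ≥0∞ :=
  ENNReal.ofReal (psucc Λ E M) / bestSucc F E M

/-- The maximal advantage of `Λ` over `F`, over all finite ensembles and measurements. -/
def maxAdvantage (Λ : SuperOp n m) (F : Set (SuperOp n m)) : ℝ≥0∞ :=
  ⨆ (N : ℕ) (E : Ensemble N (n × n)) (M : Measurement N (n × m)), advantage Λ F E M

/-- `s` is feasible if `(Λ + s Θ) / (1 + s)` lies in `F` for some channel `Θ`. -/
def IsFeasible (F : Set (SuperOp n m)) (Λ : SuperOp n m) (s : ℝ≥0) : Prop :=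
  ∃ Θ : SuperOp n m, IsChannel Θ ∧ (1 + (s : ℝ))⁻¹ • (Λ + (s : ℝ) • Θ) ∈ F

/-- The generalized robustness of `Λ` with respect to `F`, equal to `∞` if no `s` is feasible. -/
def robustness (F : Set (SuperOp n m)) (Λ : SuperOp n m) : ℝ≥0∞ :=
  ⨅ (s : ℝ≥0) (_ : IsFeasible F Λ s), (s : ℝ≥0∞)

end Task

end ChannelQRT

end

/-!
The identity holds for each convex set `F k` separately, and the robustness of a union is the
infimum of the robustnesses. For a convex set `F` of channels everything is expressed by Choi
operators: `s` is feasible exactly if `choi Λ ≤ (1 + s) choi Ξ` for some `Ξ ∈ F`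
(`isFeasible_iff`), and success probabilities are linear in the Choi operator and nonnegative on
positive ones. Hence `psucc Λ ≤ (1 + s) psucc Ξ` in every task, and no advantage exceeds
`1 + robustness F Λ` (`maxAdvantage_le`).

Conversely, one task attains this value. A positive witness `W` is turned into a task with two
labels, in which the maximally entangled state is sent with certainty and the first effect is
proportional to `W`; its success probability is proportional to `tr (W choi Φ)`
(`exists_task_psucc_eq`). So it suffices to find `W ≥ 0` with `tr (W choi Λ) > 0` and
`(1 + R) tr (W choi Ξ) ≤ tr (W choi Λ)` on `F`, where `R` is the robustness (`exists_witness`).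
If `F` is empty, `W = 1` will do. Otherwise take `Ξ₀ ∈ F` whose Choi operator has least kernel
(`exists_ker_minimal`), so that this kernel lies in the kernel of `choi Ξ` for every `Ξ ∈ F`. If
`choi Λ` does not vanish on it, a rank one operator supported in the kernel is a witness for an
infinite advantage. Otherwise `R` is finite, and with `Q` the projection onto the kernel, the
convex set of all `(1 + R) choi Ξ - choi Λ + t Q`, `t ≥ 0`, has no positive definite element, as
such an element would allow a smaller `R`. Hahn-Banach separation from the cone of positive
definite matrices yields `W`; it vanishes on `Q`, and because `choi Ξ₀ + Q` is positive definite,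
`tr (W choi Ξ₀) > 0`. The argument works at the critical value itself, so the maximum is attained
although `F` need not be closed.

The remaining attainment claims follow from compactness of the set of Choi operators of channels
(`isCompact_setOf_posSemidef_trace_eq`).
-/

noncomputable section

namespace ChannelQRT

open Matrix

/-! ### Separation and duality for positive semidefinite matrices -/

section Cone

variable {d : Type*} [Fintype d]

theorem isClosed_setOf_posSemidef : IsClosed {A : Matrix d d ℂ | A.PosSemidef} := by
  have h : {A : Matrix d d ℂ | A.PosSemidef} =
      {A | Aᴴ = A} ∩ ⋂ x : d → ℂ, {A | 0 ≤ star x ⬝ᵥ A *ᵥ x} := by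
    ext A
    simp [posSemidef_iff_dotProduct_mulVec, IsHermitian]
  rw [h]
  refine (isClosed_eq (by fun_prop) continuous_id).inter (isClosed_iInter fun x => ?_)
  exact isClosed_le continuous_const (by fun_prop)

open scoped MatrixOrder in
theorem re_trace_mul_nonneg {A B : Matrix d d ℂ} (hA : A.PosSemidef) (hB : B.PosSemidef) :
    0 ≤ (A * B).trace.re := by
  classical
  obtain ⟨C, rfl⟩ := CStarAlgebra.nonneg_iff_eq_star_mul_self.mp hB.nonneg
  rw [star_eq_conjTranspose, ← mul_assoc, trace_mul_comm, ← mul_assoc]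
  exact (Complex.le_def.1 (hA.mul_mul_conjTranspose_same C).trace_nonneg).1

variable [DecidableEq d]

open scoped MatrixOrder in
theorem re_trace_mul_pos {W A : Matrix d d ℂ} (hW : W.PosSemidef) (hW0 : W ≠ 0)
    (hA : A.PosDef) : 0 < (W * A).trace.re := by
  obtain ⟨C, rfl⟩ := CStarAlgebra.nonneg_iff_eq_star_mul_self.mp hW.nonneg
  rw [star_eq_conjTranspose] at *
  have hp : (C * A * Cᴴ).PosSemidef := hA.posSemidef.mul_mul_conjTranspose_same C
  rw [mul_assoc, trace_mul_comm]
  refine lt_of_le_of_ne (Complex.le_def.1 hp.trace_nonneg).1 fun h => hW0 ?_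
  obtain ⟨D, hD, rfl⟩ := CStarAlgebra.isStrictlyPositive_iff_eq_star_mul_self.mp
    hA.isStrictlyPositive
  have h0 : ((D * Cᴴ)ᴴ * (D * Cᴴ)).trace = 0 := by
    have e : (D * Cᴴ)ᴴ * (D * Cᴴ) = C * (star D * D) * Cᴴ := by
      simp [star_eq_conjTranspose, mul_assoc]
    rw [e]
    exact Complex.ext h.symm (Complex.le_def.1 hp.trace_nonneg).2.symm
  rw [trace_conjTranspose_mul_self_eq_zero_iff] at h0
  have : Cᴴ = 0 := by
    lift D to (Matrix d d ℂ)ˣ using hD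
    simpa [← mul_assoc] using congr(D⁻¹ * $h0)
  simp [this]

open scoped MatrixOrder Matrix.Norms.L2Operator in
theorem norm_smul_one_sub_posSemidef (Y : Matrix d d ℂ) (hY : Y.IsHermitian) :
    ((‖Y‖ : ℝ) • (1 : Matrix d d ℂ) - Y).PosSemidef := by
  have := IsSelfAdjoint.le_algebraMap_norm_self (a := Y) hY
  rwa [Algebra.algebraMap_eq_smul_one, le_iff] at this

open scoped MatrixOrder Matrix.Norms.L2Operator in
/-- A positive definite matrix stays positive after subtracting a small multiple of a Hermitian one:
it dominates a positive multiple of the identity, which dominates the Hermitian matrix up to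
scale. -/
theorem _root_.Matrix.PosDef.exists_sub_smul_posSemidef {X Y : Matrix d d ℂ} (hX : X.PosDef)
    (hY : Y.IsHermitian) : ∃ ε : ℝ, 0 < ε ∧ (X - ε • Y).PosSemidef := by
  cases isEmpty_or_nonempty d
  · exact ⟨1, one_pos, Subsingleton.elim 0 (X - (1 : ℝ) • Y) ▸ PosSemidef.zero⟩
  obtain ⟨r, hr, hrX⟩ := (CFC.exists_pos_algebraMap_le_iff (A := Matrix d d ℂ) (a := X)
    hX.isHermitian).2 fun x hx => hX.isStrictlyPositive.spectrum_pos hx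
  rw [Algebra.algebraMap_eq_smul_one, le_iff] at hrX
  have hY' := norm_smul_one_sub_posSemidef Y hY
  refine ⟨r / (‖Y‖ + 1), by positivity, ?_⟩
  have e : X - (r / (‖Y‖ + 1)) • Y = (X - r • 1) + (r / (‖Y‖ + 1)) • (‖Y‖ • 1 - Y)
      + (r / (‖Y‖ + 1)) • (1 : Matrix d d ℂ) := by
    have : r = r / (‖Y‖ + 1) * ‖Y‖ + r / (‖Y‖ + 1) := by field_simp
    nth_rw 2 [this]
    module
  rw [e]
  exact (hrX.add (hY'.smul (by positivity))).add (PosSemidef.one.smul (by positivity))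

/-- The orthogonal projection `Q` onto the kernel of a positive semidefinite `A`, read off from the
spectral decomposition: it replaces the zero eigenvalues by one and the others by zero. -/
theorem exists_kernel_projection {A : Matrix d d ℂ} (hA : A.PosSemidef) :
    ∃ Q : Matrix d d ℂ, Q.PosSemidef ∧ Q * Q = Q ∧ A * Q = 0 ∧ (A + Q).PosDef := by
  set U := hA.isHermitian.eigenvectorUnitary with hU
  set ev := hA.isHermitian.eigenvalues with hev
  have hs : A = (U : Matrix d d ℂ) * diagonal (fun i => (ev i : ℂ)) * star (U : Matrix d d ℂ) := by
    have := hA.isHermitian.spectral_theorem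
    simpa [Unitary.conjStarAlgAut_apply, Function.comp_def] using this
  have hUU : star (U : Matrix d d ℂ) * U = 1 := by simp
  let q : d → ℂ := fun i => if ev i = 0 then 1 else 0
  have hconj : ∀ a b : d → ℂ, (U : Matrix d d ℂ) * diagonal a * star (U : Matrix d d ℂ) *
      ((U : Matrix d d ℂ) * diagonal b * star (U : Matrix d d ℂ)) =
      (U : Matrix d d ℂ) * diagonal (a * b) * star (U : Matrix d d ℂ) := by
    intro a b
    calc _ = (U : Matrix d d ℂ) * diagonal a * (star (U : Matrix d d ℂ) * U) * diagonal b *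
          star (U : Matrix d d ℂ) := by simp only [mul_assoc]
      _ = _ := by
        rw [hUU, mul_one, mul_assoc (U : Matrix d d ℂ), diagonal_mul_diagonal]; rfl
  refine ⟨(U : Matrix d d ℂ) * diagonal q * star (U : Matrix d d ℂ), ?_, ?_, ?_, ?_⟩
  · refine PosSemidef.mul_mul_conjTranspose_same (PosSemidef.diagonal fun i => ?_) _
    simp only [q]; split_ifs <;> simp
  · rw [hconj]
    congr 3
    ext i
    simp [q]
  · nth_rw 1 [hs]
    rw [hconj]
    have : (fun i => (ev i : ℂ)) * q = 0 := by
      ext i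
      simp [q]
    simp [this]
  · nth_rw 1 [hs]
    rw [← add_mul, ← mul_add, diagonal_add]
    refine (IsUnit.posDef_star_right_conjugate_iff ?_).2 (PosDef.diagonal fun i => ?_)
    · exact (Unitary.toUnits U).isUnit
    · have := hA.eigenvalues_nonneg i
      simp only [q]
      split_ifs with h
      · simp [h]
      · simpa using lt_of_le_of_ne this (Ne.symm h)

theorem exists_re_trace_mul_eq (f : Matrix d d ℂ →ₗ[ℝ] ℝ) :
    ∃ W : Matrix d d ℂ, ∀ X, f X = (W * X).trace.re := by
  refine ⟨of fun j i => (f (single i j 1) : ℂ) - (f (single i j Complex.I) : ℂ) * Complex.I,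
    fun X => ?_⟩
  have hX : X = ∑ i, ∑ j, ((X i j).re • single i j (1 : ℂ) +
      (X i j).im • single i j Complex.I) := by
    conv_lhs => rw [matrix_eq_sum_single X]
    refine Finset.sum_congr rfl fun i _ => Finset.sum_congr rfl fun j _ => ?_
    rw [smul_single, smul_single, ← single_add]
    congr 1
    simpa [mul_comm] using (Complex.re_add_im (X i j)).symm
  conv_lhs => rw [hX]
  simp only [map_sum, map_add, map_smul, trace, diag, mul_apply, Complex.re_sum, of_apply]
  rw [Finset.sum_comm]
  refine Finset.sum_congr rfl fun i _ => Finset.sum_congr rfl fun j _ => ?_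
  simp [mul_comm]

/-- On Hermitian matrices every real functional is the trace pairing with a Hermitian matrix. -/
theorem exists_isHermitian_re_trace_mul_eq (f : Matrix d d ℂ →ₗ[ℝ] ℝ) :
    ∃ W : Matrix d d ℂ, W.IsHermitian ∧ ∀ X : Matrix d d ℂ, X.IsHermitian →
      f X = (W * X).trace.re := by
  obtain ⟨W, hW⟩ := exists_re_trace_mul_eq f
  refine ⟨(2⁻¹ : ℝ) • (W + Wᴴ), ?_, fun X hX => ?_⟩
  · rw [IsHermitian, conjTranspose_smul]
    simp [add_comm]
  · have h : (Wᴴ * X).trace.re = (W * X).trace.re := by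
      conv_lhs => rw [← hX.eq, ← conjTranspose_mul, trace_conjTranspose, trace_mul_comm]
      simp
    rw [hW X, smul_mul, trace_smul, add_mul, trace_add, Complex.smul_re, Complex.add_re, h,
      smul_eq_mul]
    ring

open scoped Matrix.Norms.L2Operator in
/-- Positive definite matrices form no open set among all complex matrices; the condition on the
Hermitian part gives a cone with interior, in which a Hahn-Banach separation is possible. -/
theorem _root_.Matrix.PosDef.mem_interior {X : Matrix d d ℂ} (hX : X.PosDef) :
    X ∈ interior {Z : Matrix d d ℂ | (Z + Zᴴ).PosSemidef} := by
  obtain ⟨r, hr, hrX⟩ := hX.exists_sub_smul_posSemidef (isHermitian_one (n := d) (α := ℂ))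
  rw [mem_interior_iff_mem_nhds, Metric.mem_nhds_iff]
  refine ⟨r, hr, fun Z hZ => ?_⟩
  rw [Metric.mem_ball, dist_eq_norm] at hZ
  have hY : (-((Z - X) + (Z - X)ᴴ)).IsHermitian := by
    simp [IsHermitian, add_comm, sub_eq_add_neg]
  have hn : ‖-((Z - X) + (Z - X)ᴴ)‖ ≤ 2 * r := by
    rw [norm_neg]
    refine (norm_add_le _ _).trans ?_
    rw [l2_opNorm_conjTranspose]
    linarith
  have e : Z + Zᴴ = (2 : ℝ) • (X - r • 1) + ((2 * r - ‖-((Z - X) + (Z - X)ᴴ)‖) • 1 +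
      (‖-((Z - X) + (Z - X)ᴴ)‖ • 1 - -((Z - X) + (Z - X)ᴴ))) := by
    simp only [conjTranspose_sub, hX.isHermitian.eq]
    module
  change (Z + Zᴴ).PosSemidef
  rw [e]
  exact (hrX.smul (by norm_num : (0 : ℝ) ≤ 2)).add ((PosSemidef.one.smul (sub_nonneg.2 hn)).add
    (norm_smul_one_sub_posSemidef _ hY))

/-- A convex set of Hermitian matrices without positive definite element is separated from the
positive cone by a nonzero positive semidefinite matrix. -/
theorem exists_posSemidef_separating {S : Set (Matrix d d ℂ)} (hS : Convex ℝ S)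
    (hne : S.Nonempty) (hH : ∀ A ∈ S, A.IsHermitian) (hpos : ∀ A ∈ S, ¬ A.PosDef) :
    ∃ W : Matrix d d ℂ, W.PosSemidef ∧ W ≠ 0 ∧ ∀ A ∈ S, (W * A).trace.re ≤ 0 := by
  set C : Set (Matrix d d ℂ) := {X | (X + Xᴴ).PosSemidef} with hC
  have hCconv : Convex ℝ C := by
    intro X hX Y hY a b ha hb _
    have e : (a • X + b • Y) + (a • X + b • Y)ᴴ = a • (X + Xᴴ) + b • (Y + Yᴴ) := by
      simp only [conjTranspose_add, conjTranspose_smul, star_trivial]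
      module
    change ((a • X + b • Y) + (a • X + b • Y)ᴴ).PosSemidef
    rw [e]
    exact (PosSemidef.smul hX ha).add (PosSemidef.smul hY hb)
  have hone : ∀ X : Matrix d d ℂ, X.PosDef → X ∈ interior C :=
    fun X hX => hX.mem_interior
  have hdisj : Disjoint (interior C) S := by
    rw [Set.disjoint_left]
    intro X hX hXS
    refine hpos X hXS ?_
    have hcont : Filter.Tendsto (fun ε : ℝ => X - ε • (1 : Matrix d d ℂ)) (nhdsWithin 0 (Set.Ioi 0))
        (nhds X) := by
      have : Continuous fun ε : ℝ => X - ε • (1 : Matrix d d ℂ) := by fun_prop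
      simpa using (this.tendsto 0).mono_left nhdsWithin_le_nhds
    obtain ⟨ε, hεC, hε⟩ := ((hcont.eventually (mem_interior_iff_mem_nhds.1 hX)).and
      self_mem_nhdsWithin).exists
    have hε' : 0 < ε := hε
    have h1 : (2⁻¹ : ℝ) • ((X - ε • 1) + (X - ε • 1)ᴴ) + ε • (1 : Matrix d d ℂ) = X := by
      rw [conjTranspose_sub, conjTranspose_smul, (hH X hXS).eq]
      simp only [conjTranspose_one, star_trivial]
      module
    rw [← h1]
    exact (PosDef.smul PosDef.one hε').posSemidef_add
      (PosSemidef.smul hεC (by norm_num : (0 : ℝ) ≤ 2⁻¹))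
  obtain ⟨f, u, hfu, hu⟩ := geometric_hahn_banach_open hCconv.interior isOpen_interior hS hdisj
  obtain ⟨W, hW, hfW⟩ := exists_isHermitian_re_trace_mul_eq (-f : Matrix d d ℂ →L[ℝ] ℝ).toLinearMap
  have hfW' : ∀ X : Matrix d d ℂ, X.IsHermitian → -f X = (W * X).trace.re := hfW
  -- The separated set contains all positive multiples of positive definite matrices, so the bound
  -- `f < u` on it improves to `f ≤ 0`, and `u ≥ 0`.
  have hfneg : ∀ X : Matrix d d ℂ, X.PosDef → f X ≤ 0 := by
    intro X hX
    by_contra! h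
    have := hfu _ (hone _ (hX.smul (α := ℝ) (a := (|u| + 1) / f X) (by positivity)))
    rw [map_smul, smul_eq_mul, div_mul_cancel₀ _ h.ne'] at this
    linarith [le_abs_self u]
  have hu0 : 0 ≤ u := by
    refine le_of_forall_pos_lt_add fun ε hε => ?_
    by_contra! h
    have h1 := hfneg 1 PosDef.one
    have := hfu _ (hone _ (PosDef.one.smul (α := ℝ) (a := ε / (|f 1| + 1)) (by positivity)))
    rw [map_smul, smul_eq_mul] at this
    have h2 : ε / (|f 1| + 1) * |f 1| ≤ ε := by
      rw [div_mul_eq_mul_div, div_le_iff₀ (by positivity)]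
      nlinarith [abs_nonneg (f 1)]
    rw [abs_of_nonpos h1] at h2 this
    linarith
  refine ⟨W, ?_, ?_, fun A hA => ?_⟩
  · refine PosSemidef.of_dotProduct_mulVec_nonneg hW fun x => ?_
    have hx := posSemidef_vecMulVec_self_star x
    have e : star x ⬝ᵥ W *ᵥ x = (W * vecMulVec x (star x)).trace := by
      rw [mul_vecMulVec, trace_vecMulVec, dotProduct_comm]
    have him : (star x ⬝ᵥ W *ᵥ x).im = 0 := hW.im_star_dotProduct_mulVec_self x
    rw [Complex.le_def]
    refine ⟨?_, him.symm⟩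
    rw [e, ← hfW' _ hx.isHermitian, Complex.zero_re, neg_nonneg]
    -- Rank one matrices are limits of positive definite ones.
    refine le_of_forall_pos_le_add fun ε hε => ?_
    have h1 := hfneg _ ((PosDef.one.smul (α := ℝ) (a := ε / (|f 1| + 1))
      (by positivity)).posSemidef_add hx)
    rw [map_add, map_smul, smul_eq_mul] at h1
    have h2 : ε / (|f 1| + 1) * |f 1| ≤ ε := by
      rw [div_mul_eq_mul_div, div_le_iff₀ (by positivity)]
      nlinarith [abs_nonneg (f 1)]
    have h3 : ε / (|f 1| + 1) * -|f 1| ≤ ε / (|f 1| + 1) * f 1 :=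
      mul_le_mul_of_nonneg_left (neg_abs_le _) (by positivity)
    linarith
  · rintro rfl
    obtain ⟨A, hA⟩ := hne
    have h1 := hfW' A (hH A hA)
    have h2 := hfW' 1 isHermitian_one
    have h3 := hfu 1 (hone 1 PosDef.one)
    have h4 := hu A hA
    simp at h1 h2
    linarith
  · rw [← hfW' A (hH A hA)]
    linarith [hu A hA]

omit [DecidableEq d] in
theorem mul_eq_zero_of_ker_le {A B Q : Matrix d d ℂ}
    (h : ∀ x, A *ᵥ x = 0 → B *ᵥ x = 0) (hAQ : A * Q = 0) : B * Q = 0 := by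
  ext i j
  have hA : A *ᵥ (Q.col j) = 0 := by
    ext k
    exact congrFun (congrFun hAQ k) j
  exact congrFun (h _ hA) i

/-- A matrix `B` supported on the range of `1 - Q` can be recovered from `B + t Q` by
compression. -/
theorem posSemidef_of_add_smul_projection {B Q : Matrix d d ℂ} {t : ℝ} (hB : B.IsHermitian)
    (hQ : Q.IsHermitian) (hQQ : Q * Q = Q) (hBQ : B * Q = 0) (h : (B + t • Q).PosSemidef) :
    B.PosSemidef := by
  have hQB : Q * B = 0 := by
    simpa [hB.eq, hQ.eq] using congrArg conjTranspose hBQ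
  have := h.mul_mul_conjTranspose_same (1 - Q)
  have e : (1 - Q) * (B + t • Q) * (1 - Q)ᴴ = B := by
    simp [hQ.eq, sub_mul, mul_sub, mul_add, hBQ, hQB, hQQ]
  rwa [e] at this

omit [DecidableEq d] in
/-- A convex set of positive semidefinite matrices has an element of least kernel: the kernel of a
midpoint is the intersection of the kernels, so a minimal kernel is contained in every other one. -/
theorem exists_ker_minimal {S : Set (Matrix d d ℂ)} (hS : Convex ℝ S) (hne : S.Nonempty)
    (hpsd : ∀ A ∈ S, A.PosSemidef) :
    ∃ A ∈ S, ∀ B ∈ S, ∀ x, A *ᵥ x = 0 → B *ᵥ x = 0 := by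
  obtain ⟨A, hA, hmin⟩ := exists_minimalFor_of_wellFoundedLT (· ∈ S)
    (fun A : Matrix d d ℂ => LinearMap.ker A.mulVecLin) hne
  refine ⟨A, hA, fun B hB x hx => ?_⟩
  have hmid := hS hA hB (by norm_num : (0 : ℝ) ≤ 2⁻¹) (by norm_num : (0 : ℝ) ≤ 2⁻¹) (by norm_num)
  have key : ∀ y, ((2⁻¹ : ℝ) • A + (2⁻¹ : ℝ) • B) *ᵥ y = 0 → A *ᵥ y = 0 ∧ B *ᵥ y = 0 := by
    intro y hy
    have h0 : star y ⬝ᵥ A *ᵥ y + star y ⬝ᵥ B *ᵥ y = 0 := by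
      rw [← smul_add, smul_mulVec, smul_eq_zero] at hy
      rw [← dotProduct_add, ← add_mulVec, hy.resolve_left (by norm_num), dotProduct_zero]
    have := (add_eq_zero_iff_of_nonneg ((hpsd A hA).dotProduct_mulVec_nonneg y)
      ((hpsd B hB).dotProduct_mulVec_nonneg y)).1 h0
    exact ⟨((hpsd A hA).dotProduct_mulVec_zero_iff y).1 this.1,
      ((hpsd B hB).dotProduct_mulVec_zero_iff y).1 this.2⟩
  have := hmin hmid (fun y hy => (key y hy).1) (show x ∈ LinearMap.ker A.mulVecLin from hx)
  exact (key x this).2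

omit [DecidableEq d] in
/-- If `L` does not vanish on the common kernel of `S`, a rank one witness detects `L` and vanishes
on all of `S`. This is the case of infinite robustness. -/
theorem exists_witness_of_not_ker_le {S : Set (Matrix d d ℂ)} {A L : Matrix d d ℂ}
    (hA : ∀ B ∈ S, ∀ x, A *ᵥ x = 0 → B *ᵥ x = 0)
    (hL : L.PosSemidef) {x : d → ℂ} (hAx : A *ᵥ x = 0) (hLx : L *ᵥ x ≠ 0) :
    ∃ W : Matrix d d ℂ, W.PosSemidef ∧ 0 < (W * L).trace.re ∧
      ∀ B ∈ S, (W * B).trace.re = 0 := by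
  have e : ∀ B : Matrix d d ℂ, (vecMulVec x (star x) * B).trace = star x ⬝ᵥ B *ᵥ x := by
    intro B
    rw [trace_mul_comm, mul_vecMulVec, trace_vecMulVec, dotProduct_comm]
  refine ⟨vecMulVec x (star x), posSemidef_vecMulVec_self_star x, ?_, fun B hB => ?_⟩
  · rw [e]
    have h := hL.dotProduct_mulVec_nonneg x
    refine (Complex.lt_def.1 (lt_of_le_of_ne h fun h0 => hLx ?_)).1
    exact (hL.dotProduct_mulVec_zero_iff x).1 h0.symm
  · rw [e, hA B hB x hAx, dotProduct_zero, Complex.zero_re]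

/-- Inclusion of kernels suffices for domination up to a factor: `A + Q` is positive definite, hence
dominates a multiple of `L`, and compression by `1 - Q` removes `Q`. -/
theorem exists_smul_sub_posSemidef_of_ker_le {A L : Matrix d d ℂ} (hA : A.PosSemidef)
    (hL : L.PosSemidef) (h : ∀ x, A *ᵥ x = 0 → L *ᵥ x = 0) :
    ∃ c : ℝ, 0 ≤ c ∧ (c • A - L).PosSemidef := by
  obtain ⟨Q, hQ, hQQ, hAQ, hpos⟩ := exists_kernel_projection hA
  obtain ⟨ε, hε, hp⟩ := hpos.exists_sub_smul_posSemidef hL.isHermitian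
  refine ⟨ε⁻¹, by positivity, ?_⟩
  refine posSemidef_of_add_smul_projection (t := ε⁻¹)
    ((hA.smul (by positivity : 0 ≤ ε⁻¹)).isHermitian.sub hL.isHermitian) hQ.isHermitian hQQ ?_ ?_
  · rw [sub_mul, smul_mul, hAQ, mul_eq_zero_of_ker_le h hAQ]
    simp
  · have e : ε⁻¹ • A - L + ε⁻¹ • Q = ε⁻¹ • (A + Q - ε • L) := by
      rw [smul_sub, smul_smul, inv_mul_cancel₀ hε.ne']
      module
    rw [e]
    exact hp.smul (by positivity)

/-- The duality at the critical value `r`: if no `c < r` and `B ∈ S` satisfy `L ≤ c B`, some witness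
separates `L` from `S` by the full factor `r`. Here `A` is an element of `S` of least kernel.
Neither closedness nor boundedness of `S` is needed. -/
theorem exists_witness_of_ker_le {S : Set (Matrix d d ℂ)} (hS : Convex ℝ S)
    (hpsd : ∀ A ∈ S, A.PosSemidef) {A L : Matrix d d ℂ} (hAS : A ∈ S)
    (hA : ∀ B ∈ S, ∀ x, A *ᵥ x = 0 → B *ᵥ x = 0) (hL : L.PosSemidef)
    (hLA : ∀ x, A *ᵥ x = 0 → L *ᵥ x = 0) {r : ℝ} (hr : 0 < r)
    (hfeas : ∀ c < r, ∀ B ∈ S, ¬ (c • B - L).PosSemidef) :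
    ∃ W : Matrix d d ℂ, W.PosSemidef ∧ 0 < (W * L).trace.re ∧
      ∀ B ∈ S, r * (W * B).trace.re ≤ (W * L).trace.re := by
  obtain ⟨Q, hQ, hQQ, hAQ, hpos⟩ := exists_kernel_projection (hpsd A hAS)
  have hherm : ∀ B ∈ S, ∀ c : ℝ, (c • B - L).IsHermitian := fun B hB c =>
    IsHermitian.sub (by simp [IsHermitian, (hpsd B hB).isHermitian.eq]) hL.isHermitian
  have hBQ : ∀ B ∈ S, ∀ c : ℝ, (c • B - L) * Q = 0 := fun B hB c => by
    rw [sub_mul, smul_mul, mul_eq_zero_of_ker_le (hA B hB) hAQ, mul_eq_zero_of_ker_le hLA hAQ]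
    simp
  -- Adding multiples of the kernel projection `Q` makes up for `S` having no positive definite
  -- element, and forces the witness to vanish on `Q`, since `t` is unbounded.
  have hsep : ∃ W : Matrix d d ℂ, W.PosSemidef ∧ W ≠ 0 ∧
      ∀ X ∈ {X | ∃ B ∈ S, ∃ t : ℝ, 0 ≤ t ∧ X = r • B - L + t • Q}, (W * X).trace.re ≤ 0 := by
    refine exists_posSemidef_separating ?_ ?_ ?_ ?_
    · rintro _ ⟨B, hB, t, ht, rfl⟩ _ ⟨B', hB', t', ht', rfl⟩ a b ha hb hab
      refine ⟨a • B + b • B', hS hB hB' ha hb hab, a * t + b * t', by positivity, ?_⟩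
      obtain rfl : b = 1 - a := by linarith
      module
    · exact ⟨_, A, hAS, 0, le_rfl, rfl⟩
    · rintro _ ⟨B, hB, t, ht, rfl⟩
      exact (hherm B hB r).add (hQ.smul ht).isHermitian
    · rintro _ ⟨B, hB, t, ht, rfl⟩ hp
      -- A positive definite element would leave room to lower `r` to `r - ε`.
      obtain ⟨ε, hε, h⟩ := hp.exists_sub_smul_posSemidef (hpsd B hB).isHermitian
      refine hfeas (r - ε) (by linarith) B hB ?_
      refine posSemidef_of_add_smul_projection (t := t) (hherm B hB _) hQ.isHermitian hQQ
        (hBQ B hB _) ?_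
      convert h using 1
      module
  obtain ⟨W, hW, hW0, hWS⟩ := hsep
  have hle : ∀ B ∈ S, ∀ t : ℝ, 0 ≤ t →
      r * (W * B).trace.re - (W * L).trace.re + t * (W * Q).trace.re ≤ 0 := by
    intro B hB t ht
    have := hWS _ ⟨B, hB, t, ht, rfl⟩
    simpa [mul_add, mul_sub, trace_add, trace_sub] using this
  have hQ0 : (W * Q).trace.re ≤ 0 := by
    by_contra! hq
    have := hle A hAS ((|(W * L).trace.re - r * (W * A).trace.re| + 1) / (W * Q).trace.re)
      (by positivity)
    rw [div_mul_cancel₀ _ hq.ne'] at this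
    linarith [le_abs_self ((W * L).trace.re - r * (W * A).trace.re)]
  have hWA : 0 < (W * A).trace.re := by
    have := re_trace_mul_pos hW hW0 hpos
    rw [mul_add, trace_add, Complex.add_re] at this
    linarith
  refine ⟨W, hW, ?_, fun B hB => ?_⟩
  · have := hle A hAS 0 le_rfl
    have := mul_pos hr hWA
    linarith
  · linarith [hle B hB 0 le_rfl]

open scoped MatrixOrder in
theorem norm_apply_le_re_trace {A : Matrix d d ℂ} (hA : A.PosSemidef) (i j : d) :
    ‖A i j‖ ≤ A.trace.re := by
  have hdiag : ∀ k, (A k k).re ≤ A.trace.re := fun k => by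
    rw [trace, Complex.re_sum]
    exact Finset.single_le_sum (f := fun l => (A l l).re)
      (fun l _ => (Complex.le_def.1 hA.diag_nonneg).1) (Finset.mem_univ k)
  suffices h : ‖A i j‖ ≤ ((A i i).re + (A j j).re) / 2 by linarith [hdiag i, hdiag j]
  clear hdiag
  obtain ⟨C, rfl⟩ := CStarAlgebra.nonneg_iff_eq_star_mul_self.mp hA.nonneg
  have hd : ∀ k, ((star C * C) k k).re = ∑ l, ‖C l k‖ ^ 2 := fun k => by
    rw [mul_apply, Complex.re_sum]
    refine Finset.sum_congr rfl fun l _ => ?_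
    rw [star_apply, RCLike.star_def, Complex.conj_mul', ← Complex.ofReal_pow, Complex.ofReal_re]
  rw [hd, hd, ← Finset.sum_add_distrib, Finset.sum_div, mul_apply]
  refine (norm_sum_le _ _).trans (Finset.sum_le_sum fun l _ => ?_)
  rw [norm_mul, star_apply, norm_star]
  nlinarith [sq_nonneg (‖C l i‖ - ‖C l j‖)]

theorem isCompact_setOf_posSemidef_trace_eq (c : ℂ) :
    IsCompact {A : Matrix d d ℂ | A.PosSemidef ∧ A.trace = c} := by
  refine IsCompact.of_isClosed_subset (s := {A : Matrix d d ℂ | ∀ i j, A i j ∈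
    Metric.closedBall 0 c.re}) ?_
    (isClosed_setOf_posSemidef.inter (isClosed_eq (by fun_prop) continuous_const)) ?_
  · have := isCompact_univ_pi fun _ : d => isCompact_univ_pi fun _ : d =>
      isCompact_closedBall (0 : ℂ) c.re
    have e : {A : d → d → ℂ | ∀ i j, A i j ∈ Metric.closedBall 0 c.re} =
        Set.univ.pi fun _ => Set.univ.pi fun _ => Metric.closedBall 0 c.re := by
      ext A
      simp [Set.mem_pi]
    rw [← e] at this
    exact this
  · rintro A ⟨hA, rfl⟩ i j
    simpa using norm_apply_le_re_trace hA i j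

end Cone

/-! ### Choi operators and tasks -/

section Choi

variable {n m : Type*} [Fintype n] [DecidableEq n]

theorem choi_apply (Φ : SuperOp n m) (p q : n × m) :
    choi Φ p q = Φ (single p.1 q.1 1) p.2 q.2 := by
  simp only [choi, Matrix.sum_apply, kroneckerMap_apply]
  rw [Finset.sum_eq_single p.1, Finset.sum_eq_single q.1]
  · simp
  · intro j _ hj
    simp [hj]
  · simp
  · intro i _ hi
    refine Finset.sum_eq_zero fun j _ => ?_
    simp [hi]
  · simp

theorem choi_add (Φ Ψ : SuperOp n m) : choi (Φ + Ψ) = choi Φ + choi Ψ := by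
  ext p q
  simp [choi_apply]

theorem choi_sub (Φ Ψ : SuperOp n m) : choi (Φ - Ψ) = choi Φ - choi Ψ := by
  ext p q
  simp [choi_apply]

theorem choi_smul (c : ℝ) (Φ : SuperOp n m) : choi (c • Φ) = c • choi Φ := by
  ext p q
  simp [choi_apply]

/-- The Choi operator as a real-linear map. -/
def choiLinear : SuperOp n m →ₗ[ℝ] Matrix (n × m) (n × m) ℂ where
  toFun := choi
  map_add' := choi_add
  map_smul' := choi_smul

theorem apply_eq_sum_choi (Φ : SuperOp n m) (X : Matrix n n ℂ) (x y : m) :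
    Φ X x y = ∑ i, ∑ j, X i j * choi Φ (i, x) (j, y) := by
  conv_lhs => rw [matrix_eq_sum_single X]
  simp only [map_sum, Matrix.sum_apply, choi_apply]
  refine Finset.sum_congr rfl fun i _ => Finset.sum_congr rfl fun j _ => ?_
  have : single i j (X i j) = X i j • single i j (1 : ℂ) := by simp
  rw [this, map_smul]
  rfl

theorem choi_injective : Function.Injective (choi : SuperOp n m → _) := by
  intro Φ Ψ h
  ext1 X
  ext x y
  rw [apply_eq_sum_choi, apply_eq_sum_choi, h]

/-- The action of a map on a block matrix, expressed through a matrix `J` in the role of its Choi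
operator: the indices of the input space are contracted. -/
def contract {n m a : Type*} [Fintype n] (X : Matrix (a × n) (a × n) ℂ)
    (J : Matrix (n × m) (n × m) ℂ) : Matrix (a × m) (a × m) ℂ :=
  of fun p q => ∑ i, ∑ j, X (p.1, i) (q.1, j) * J (i, p.2) (j, q.2)

theorem ampliation_eq_contract {a : Type*} (Φ : SuperOp n m) (X : Matrix (a × n) (a × n) ℂ) :
    ampliation a Φ X = contract X (choi Φ) := by
  ext p q
  exact apply_eq_sum_choi Φ _ p.2 q.2

omit [DecidableEq n] in
open scoped MatrixOrder in
/-- The half of Choi's theorem that derives complete positivity from positivity of the Choi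
operator. -/
theorem contract_posSemidef [Fintype m] {a : Type*} [Fintype a] {X : Matrix (a × n) (a × n) ℂ}
    {J : Matrix (n × m) (n × m) ℂ} (hX : X.PosSemidef) (hJ : J.PosSemidef) :
    (contract X J).PosSemidef := by
  classical
  obtain ⟨B, rfl⟩ := CStarAlgebra.nonneg_iff_eq_star_mul_self.mp hX.nonneg
  obtain ⟨C, rfl⟩ := CStarAlgebra.nonneg_iff_eq_star_mul_self.mp hJ.nonneg
  -- With `X = Bᴴ B` and `J = Cᴴ C`, the contraction of `X` and `J` is `Dᴴ D`, where `D` is the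
  -- contraction of `B` and `C`.
  let D : Matrix ((a × n) × (n × m)) (a × m) ℂ :=
    of fun μ p => ∑ i, B μ.1 (p.1, i) * C μ.2 (i, p.2)
  have e : contract (star B * B) (star C * C) = Dᴴ * D := by
    ext p q
    simp only [contract, of_apply, mul_apply, D, conjTranspose_apply, star_apply, star_sum,
      star_mul', Finset.sum_mul_sum]
    have h := Finset.sum_comm (s := (Finset.univ : Finset (n × n)))
      (t := (Finset.univ : Finset ((a × n) × (n × m)))) (f := fun z w =>
        (star (B w.1 (p.1, z.1)) * star (C w.2 (z.1, p.2))) *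
          (B w.1 (q.1, z.2) * C w.2 (z.2, q.2)))
    simp only [Fintype.sum_prod_type (α₁ := a × n),
      Fintype.sum_prod_type (α₁ := n) (α₂ := n)] at h ⊢
    convert h using 5
    ring
  rw [e]
  exact posSemidef_conjTranspose_mul_self D

/-- The unnormalised maximally entangled operator `∑ i j, |i⟩⟨j| ⊗ |i⟩⟨j|`. -/
def maxEntangled (n : Type*) [DecidableEq n] : Matrix (n × n) (n × n) ℂ :=
  vecMulVec (fun p => if p.1 = p.2 then 1 else 0) (star fun p => if p.1 = p.2 then 1 else 0)

theorem maxEntangled_posSemidef : (maxEntangled n).PosSemidef :=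
  posSemidef_vecMulVec_self_star _

theorem trace_maxEntangled : (maxEntangled n).trace = Fintype.card n := by
  simp [maxEntangled, trace, vecMulVec_apply, Fintype.sum_prod_type, apply_ite]

theorem ampliation_maxEntangled (Φ : SuperOp n m) :
    ampliation n Φ (maxEntangled n) = choi Φ := by
  ext p q
  rw [choi_apply]
  have : (of fun i j => maxEntangled n (p.1, i) (q.1, j)) = single p.1 q.1 (1 : ℂ) := by
    ext i j
    simp only [maxEntangled, vecMulVec_apply, of_apply, single_apply, Pi.star_apply]
    by_cases h : p.1 = i <;> by_cases h' : q.1 = j <;> simp [h, h']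
  change Φ (of fun i j => maxEntangled n (p.1, i) (q.1, j)) p.2 q.2 = _
  rw [this]

variable [Fintype m]

/-- The Choi operator is the image of the maximally entangled operator, whose reference system has
to be relabelled by `Fin k` in order to apply complete positivity. -/
theorem IsChannel.choi_posSemidef {Φ : SuperOp n m} (hΦ : IsChannel Φ) :
    (choi Φ).PosSemidef := by
  let e := Fintype.equivFin n
  have h := hΦ.completelyPositive (Fintype.card n)
    ((maxEntangled n).submatrix (Prod.map e.symm id) (Prod.map e.symm id))
    (maxEntangled_posSemidef.submatrix _)
  have := h.submatrix (Prod.map e id)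
  rw [← ampliation_maxEntangled]
  convert this using 1
  ext p q
  simp [ampliation]

theorem trace_choi {Φ : SuperOp n m} (hΦ : IsChannel Φ) :
    (choi Φ).trace = Fintype.card n := by
  have h : ∀ i, ∑ x, Φ (single i i 1) x x = 1 := fun i => by
    have := hΦ.tracePreserving (single i i 1)
    simpa [trace] using this
  simp [trace, Fintype.sum_prod_type, choi_apply, h]

theorem isChannel_of_choi_posSemidef {Φ : SuperOp n m} (h : (choi Φ).PosSemidef)
    (ht : ∀ X, (Φ X).trace = X.trace) : IsChannel Φ where
  completelyPositive k X hX := by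
    rw [ampliation_eq_contract]
    exact contract_posSemidef hX h
  tracePreserving := ht

theorem eq_of_choi_sub_posSemidef {Φ Ψ : SuperOp n m} (hΦ : IsChannel Φ) (hΨ : IsChannel Ψ)
    (h : (choi Φ - choi Ψ).PosSemidef) : Φ = Ψ := by
  have h0 : (choi Φ - choi Ψ).trace = 0 := by
    rw [trace_sub, trace_choi hΦ, trace_choi hΨ, sub_self]
  classical
  exact choi_injective (sub_eq_zero.1 (h.trace_eq_zero_iff.1 h0))

/-- Feasibility as a matrix inequality between Choi operators. For `s > 0` the complementary channel
is `((1 + s) Ξ - Λ) / s`; for `s = 0` equality of traces forces `Ξ = Λ`. -/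
theorem isFeasible_iff {F : Set (SuperOp n m)} (hF : ∀ Ξ ∈ F, IsChannel Ξ) {Λ : SuperOp n m}
    (hΛ : IsChannel Λ) (s : ℝ≥0) :
    IsFeasible F Λ s ↔ ∃ Ξ ∈ F, ((1 + (s : ℝ)) • choi Ξ - choi Λ).PosSemidef := by
  have hs : (0 : ℝ) ≤ s := s.2
  have hs1 : (1 + (s : ℝ)) ≠ 0 := by positivity
  constructor
  · rintro ⟨Θ, hΘ, hmem⟩
    refine ⟨_, hmem, ?_⟩
    rw [choi_smul, smul_smul, mul_inv_cancel₀ hs1, one_smul, choi_add, choi_smul,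
      add_sub_cancel_left]
    exact hΘ.choi_posSemidef.smul hs
  · rintro ⟨Ξ, hΞ, hp⟩
    rcases hs.eq_or_lt with h0 | h0
    · refine ⟨Λ, hΛ, ?_⟩
      rw [← h0] at hp ⊢
      have : Ξ = Λ := eq_of_choi_sub_posSemidef (hF Ξ hΞ) hΛ (by simpa using hp)
      simpa [← this] using hΞ
    · refine ⟨(s : ℝ)⁻¹ • ((1 + (s : ℝ)) • Ξ - Λ), isChannel_of_choi_posSemidef ?_ ?_, ?_⟩
      · rw [choi_smul, choi_sub, choi_smul]
        exact hp.smul (by positivity)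
      · intro X
        have e : ((s : ℝ)⁻¹ • ((1 + (s : ℝ)) • Ξ - Λ)) X =
          (s : ℝ)⁻¹ • ((1 + (s : ℝ)) • Ξ X - Λ X) := rfl
        rw [e, trace_smul, trace_sub, trace_smul, (hF Ξ hΞ).tracePreserving, hΛ.tracePreserving,
          add_smul, one_smul, add_sub_cancel_left, smul_smul, inv_mul_cancel₀ h0.ne', one_smul]
      · rw [smul_smul, mul_inv_cancel₀ h0.ne', one_smul, add_sub_cancel, smul_smul,
          inv_mul_cancel₀ hs1, one_smul]
        exact hΞ

variable [DecidableEq m]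

/-- The success probability as a function of a matrix `J` in the role of the Choi operator. -/
def psuccChoi {N : ℕ} (E : Ensemble N (n × n)) (M : Measurement N (n × m))
    (J : Matrix (n × m) (n × m) ℂ) : ℝ :=
  ∑ i, E.prob i * ((M.effect i * contract (E.state i) J).trace).re

theorem psucc_eq_psuccChoi {N : ℕ} (Φ : SuperOp n m) (E : Ensemble N (n × n))
    (M : Measurement N (n × m)) : psucc Φ E M = psuccChoi E M (choi Φ) := by
  simp only [psucc, psuccChoi, ampliation_eq_contract]

theorem continuous_psuccChoi {N : ℕ} (E : Ensemble N (n × n)) (M : Measurement N (n × m)) :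
    Continuous (psuccChoi E M) := by
  have h : ∀ i, Continuous fun J : Matrix (n × m) (n × m) ℂ => contract (E.state i) J := by
    intro i
    unfold contract
    refine continuous_matrix fun p q => ?_
    simp only [of_apply]
    fun_prop
  unfold psuccChoi
  refine continuous_finsetSum _ fun i _ => ?_
  have := h i
  fun_prop

theorem psuccChoi_nonneg {N : ℕ} (E : Ensemble N (n × n)) (M : Measurement N (n × m))
    {J : Matrix (n × m) (n × m) ℂ} (hJ : J.PosSemidef) : 0 ≤ psuccChoi E M J :=
  Finset.sum_nonneg fun i _ => mul_nonneg (E.prob_nonneg i)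
    (re_trace_mul_nonneg (M.effect_posSemidef i) (contract_posSemidef (E.state_posSemidef i) hJ))

theorem psuccChoi_sub {N : ℕ} (E : Ensemble N (n × n)) (M : Measurement N (n × m)) (c : ℝ)
    (J K : Matrix (n × m) (n × m) ℂ) :
    psuccChoi E M (c • J - K) = c * psuccChoi E M J - psuccChoi E M K := by
  have h : ∀ X : Matrix (n × n) (n × n) ℂ,
      contract X (c • J - K) = c • contract X J - contract X K := by
    intro X
    ext p q
    simp only [contract, of_apply, Matrix.sub_apply, Matrix.smul_apply, mul_sub,
      Finset.sum_sub_distrib, Finset.smul_sum, mul_smul_comm]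
  simp only [psuccChoi, h, mul_sub, mul_smul_comm, trace_sub, trace_smul, Complex.sub_re,
    Complex.smul_re, smul_eq_mul, Finset.sum_sub_distrib, Finset.mul_sum]
  congr 1
  exact Finset.sum_congr rfl fun i _ => by ring

theorem psucc_le_mul_psucc {N : ℕ} {Λ Ξ : SuperOp n m} {c : ℝ}
    (h : (c • choi Ξ - choi Λ).PosSemidef) (E : Ensemble N (n × n)) (M : Measurement N (n × m)) :
    psucc Λ E M ≤ c * psucc Ξ E M := by
  have := psuccChoi_nonneg E M h
  rw [psuccChoi_sub] at this
  rw [psucc_eq_psuccChoi, psucc_eq_psuccChoi]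
  linarith

theorem advantage_le_of_isFeasible {F : Set (SuperOp n m)} (hF : ∀ Ξ ∈ F, IsChannel Ξ)
    {Λ : SuperOp n m} (hΛ : IsChannel Λ) {s : ℝ≥0} (hs : IsFeasible F Λ s) {N : ℕ}
    (E : Ensemble N (n × n)) (M : Measurement N (n × m)) : advantage Λ F E M ≤ 1 + s := by
  obtain ⟨Ξ, hΞ, hp⟩ := (isFeasible_iff hF hΛ s).1 hs
  refine ENNReal.div_le_of_le_mul ?_
  calc ENNReal.ofReal (psucc Λ E M) ≤ ENNReal.ofReal ((1 + s) * psucc Ξ E M) :=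
        ENNReal.ofReal_le_ofReal (psucc_le_mul_psucc hp E M)
    _ = (1 + s) * ENNReal.ofReal (psucc Ξ E M) := by
        rw [ENNReal.ofReal_mul (by positivity), ENNReal.ofReal_add zero_le_one s.coe_nonneg]
        simp
    _ ≤ (1 + s) * bestSucc F E M := by
        gcongr
        exact le_iSup₂ (f := fun Ξ _ => ENNReal.ofReal (psucc Ξ E M)) Ξ hΞ

/-- Every positive semidefinite witness is, up to a positive factor, the success probability
of a task with two labels: the maximally entangled state carries the whole prior weight, and the
first effect is the rescaled witness. -/
theorem exists_task_psucc_eq [Nonempty n] {W : Matrix (n × m) (n × m) ℂ} (hW : W.PosSemidef) :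
    ∃ (E : Ensemble 2 (n × n)) (M : Measurement 2 (n × m)) (c : ℝ), 0 < c ∧
      ∀ Φ : SuperOp n m, psucc Φ E M = c * (W * choi Φ).trace.re := by
  obtain ⟨ε, hε, hp⟩ := PosDef.one.exists_sub_smul_posSemidef hW.isHermitian
  have hd : (0 : ℝ) < Fintype.card n := by exact_mod_cast Fintype.card_pos
  let E : Ensemble 2 (n × n) :=
    { prob := ![1, 0]
      prob_nonneg := by intro i; fin_cases i <;> simp
      prob_sum := by simp
      state := fun _ => (Fintype.card n : ℝ)⁻¹ • maxEntangled n
      state_posSemidef := fun _ => maxEntangled_posSemidef.smul (by positivity)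
      state_trace := fun _ => by
        rw [trace_smul, trace_maxEntangled]
        simp }
  let M : Measurement 2 (n × m) :=
    { effect := ![ε • W, 1 - ε • W]
      effect_posSemidef := by
        intro i
        fin_cases i
        · exact hW.smul hε.le
        · exact hp
      effect_sum := by simp }
  refine ⟨E, M, ε * (Fintype.card n : ℝ)⁻¹, by positivity, fun Φ => ?_⟩
  have hamp : ampliation n Φ ((Fintype.card n : ℝ)⁻¹ • maxEntangled n) =
      (Fintype.card n : ℝ)⁻¹ • choi Φ := by
    rw [← ampliation_maxEntangled]
    exact map_smul ((ampliation n Φ).restrictScalars ℝ) _ _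
  simp only [psucc, E, M, hamp, Fin.sum_univ_two]
  simp
  ring

end Choi

/-! ### Robustness as maximal advantage -/

section Duality

variable {n m : Type*} [Fintype n] [DecidableEq n] [Fintype m] [DecidableEq m]

theorem maxAdvantage_le {F : Set (SuperOp n m)} (hF : ∀ Ξ ∈ F, IsChannel Ξ) {Λ : SuperOp n m}
    (hΛ : IsChannel Λ) : maxAdvantage Λ F ≤ 1 + robustness F Λ := by
  refine iSup_le fun N => iSup_le fun E => iSup_le fun M => ?_
  rw [robustness, ENNReal.add_iInf]
  refine le_iInf fun s => ?_
  by_cases hs : IsFeasible F Λ s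
  · simpa [hs] using advantage_le_of_isFeasible hF hΛ hs E M
  · simp [hs]

omit [DecidableEq m] in
/-- Below `1 + R` no free channel dominates `Λ`. A factor `c < 1` is excluded by comparing
traces. -/
theorem not_posSemidef_of_lt [Nonempty n] {F : Set (SuperOp n m)} (hF : ∀ Ξ ∈ F, IsChannel Ξ)
    {Λ : SuperOp n m} (hΛ : IsChannel Λ) {c : ℝ}
    (hc : ENNReal.ofReal c < 1 + robustness F Λ) {Ξ : SuperOp n m} (hΞ : Ξ ∈ F) :
    ¬ (c • choi Ξ - choi Λ).PosSemidef := by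
  intro hp
  have hd : (0 : ℝ) < Fintype.card n := by exact_mod_cast Fintype.card_pos
  have ht := (Complex.le_def.1 hp.trace_nonneg).1
  rw [trace_sub, trace_smul, trace_choi (hF Ξ hΞ), trace_choi hΛ] at ht
  simp only [Complex.zero_re, Complex.sub_re, Complex.smul_re, Complex.natCast_re,
    smul_eq_mul] at ht
  have hc1 : 1 ≤ c := by nlinarith
  lift c - 1 to ℝ≥0 using by linarith with s hs
  obtain rfl : c = 1 + s := by linarith
  have hfeas : IsFeasible F Λ s := (isFeasible_iff hF hΛ s).2 ⟨Ξ, hΞ, hp⟩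
  refine hc.not_ge ?_
  rw [ENNReal.ofReal_add zero_le_one s.coe_nonneg]
  simp only [ENNReal.ofReal_one, ENNReal.ofReal_coe_nnreal]
  gcongr
  exact iInf₂_le s hfeas

omit [Fintype m] [DecidableEq m] in
theorem convex_image_choi {F : Set (SuperOp n m)} (hconv : Convex ℝ F) :
    Convex ℝ (choi '' F) :=
  hconv.linear_image choiLinear

/-- A single witness shows the whole robustness: for finite robustness it comes from the duality at
`1 + R`, for infinite robustness it vanishes on the free channels. -/
theorem exists_witness [Nonempty n] {F : Set (SuperOp n m)} (hF : ∀ Ξ ∈ F, IsChannel Ξ)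
    (hconv : Convex ℝ F) {Λ : SuperOp n m} (hΛ : IsChannel Λ) :
    ∃ W : Matrix (n × m) (n × m) ℂ, W.PosSemidef ∧ 0 < (W * choi Λ).trace.re ∧
      ∀ Ξ ∈ F, (1 + robustness F Λ) * ENNReal.ofReal (W * choi Ξ).trace.re ≤
        ENNReal.ofReal (W * choi Λ).trace.re := by
  have hd : (0 : ℝ) < Fintype.card n := by exact_mod_cast Fintype.card_pos
  rcases F.eq_empty_or_nonempty with rfl | hne
  · refine ⟨1, PosSemidef.one, ?_, by simp⟩
    rw [one_mul, trace_choi hΛ]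
    simpa using hd
  have hpsd : ∀ A ∈ choi '' F, A.PosSemidef := by
    rintro _ ⟨Ξ, hΞ, rfl⟩
    exact (hF Ξ hΞ).choi_posSemidef
  have hS := convex_image_choi hconv
  obtain ⟨_, ⟨Ξ₀, hΞ₀, rfl⟩, hmin⟩ := exists_ker_minimal hS (hne.image choi) hpsd
  have hL := hΛ.choi_posSemidef
  by_cases hker : ∀ x, choi Ξ₀ *ᵥ x = 0 → choi Λ *ᵥ x = 0
  · -- The Choi operator of `Λ` is then dominated by a multiple of that of `Ξ₀`.
    have htop : robustness F Λ ≠ ⊤ := by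
      obtain ⟨c, -, hc⟩ := exists_smul_sub_posSemidef_of_ker_le (hF Ξ₀ hΞ₀).choi_posSemidef hL hker
      intro h
      exact not_posSemidef_of_lt hF hΛ (by simp [h]) hΞ₀ hc
    obtain ⟨W, hW, hWL, hWF⟩ := exists_witness_of_ker_le (r := 1 + (robustness F Λ).toReal)
      hS hpsd ⟨Ξ₀, hΞ₀, rfl⟩ hmin hL hker (by positivity) (by
        rintro c hc _ ⟨Ξ, hΞ, rfl⟩
        refine not_posSemidef_of_lt hF hΛ ?_ hΞ
        rw [← ENNReal.ofReal_toReal htop, ← ENNReal.ofReal_one,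
          ← ENNReal.ofReal_add zero_le_one ENNReal.toReal_nonneg]
        exact (ENNReal.ofReal_lt_ofReal_iff (by positivity)).2 hc)
    refine ⟨W, hW, hWL, fun Ξ hΞ => ?_⟩
    have e : 1 + robustness F Λ = ENNReal.ofReal (1 + (robustness F Λ).toReal) := by
      rw [ENNReal.ofReal_add zero_le_one ENNReal.toReal_nonneg, ENNReal.ofReal_one,
        ENNReal.ofReal_toReal htop]
    rw [e, ← ENNReal.ofReal_mul (by positivity)]
    exact ENNReal.ofReal_le_ofReal (hWF _ ⟨Ξ, hΞ, rfl⟩)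
  · push Not at hker
    obtain ⟨x, hx, hLx⟩ := hker
    obtain ⟨W, hW, hWL, hWF⟩ := exists_witness_of_not_ker_le hmin hL hx hLx
    refine ⟨W, hW, hWL, fun Ξ hΞ => ?_⟩
    simp [hWF _ ⟨Ξ, hΞ, rfl⟩]

theorem exists_advantage_ge [Nonempty n] {F : Set (SuperOp n m)} (hF : ∀ Ξ ∈ F, IsChannel Ξ)
    (hconv : Convex ℝ F) {Λ : SuperOp n m} (hΛ : IsChannel Λ) :
    ∃ (E : Ensemble 2 (n × n)) (M : Measurement 2 (n × m)),
      1 + robustness F Λ ≤ advantage Λ F E M := by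
  obtain ⟨W, hW, hWL, hWF⟩ := exists_witness hF hconv hΛ
  obtain ⟨E, M, c, hc, hp⟩ := exists_task_psucc_eq hW
  refine ⟨E, M, ?_⟩
  have hpos : ENNReal.ofReal (psucc Λ E M) ≠ 0 := by
    rw [hp]
    simpa using mul_pos hc hWL
  rw [advantage, ENNReal.le_div_iff_mul_le (Or.inr hpos) (Or.inr ENNReal.ofReal_ne_top), bestSucc]
  simp only [ENNReal.mul_iSup]
  refine iSup₂_le fun Ξ hΞ => ?_
  rw [hp, hp, ENNReal.ofReal_mul hc.le, ENNReal.ofReal_mul hc.le, mul_left_comm]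
  gcongr
  exact hWF Ξ hΞ

theorem exists_advantage_eq [Nonempty n] {F : Set (SuperOp n m)} (hF : ∀ Ξ ∈ F, IsChannel Ξ)
    (hconv : Convex ℝ F) {Λ : SuperOp n m} (hΛ : IsChannel Λ) :
    maxAdvantage Λ F = 1 + robustness F Λ ∧
      ∃ (N : ℕ) (E : Ensemble N (n × n)) (M : Measurement N (n × m)),
        advantage Λ F E M = maxAdvantage Λ F := by
  obtain ⟨E, M, h⟩ := exists_advantage_ge hF hconv hΛ
  have hle : advantage Λ F E M ≤ maxAdvantage Λ F :=
    le_iSup_of_le 2 (le_iSup_of_le E (le_iSup_of_le M le_rfl))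
  have hge := maxAdvantage_le hF hΛ
  exact ⟨le_antisymm hge (h.trans hle), 2, E, M, le_antisymm hle (hge.trans h)⟩

omit [DecidableEq n] [DecidableEq m] in
theorem robustness_iUnion {ι : Type*} (F : ι → Set (SuperOp n m)) (Λ : SuperOp n m) :
    robustness (⋃ k, F k) Λ = ⨅ k, robustness (F k) Λ := by
  have h : ∀ s, IsFeasible (⋃ k, F k) Λ s ↔ ∃ k, IsFeasible (F k) Λ s := by
    intro s
    simp only [IsFeasible, Set.mem_iUnion]
    tauto
  simp only [robustness, h, iInf_exists]
  rw [iInf_comm]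

omit [DecidableEq m] in
theorem isCompact_image_choi {F : Set (SuperOp n m)} (hF : ∀ Ξ ∈ F, IsChannel Ξ)
    (hclosed : IsClosedSet F) : IsCompact (choi '' F) := by
  classical
  refine (isCompact_setOf_posSemidef_trace_eq (Fintype.card n : ℂ)).of_isClosed_subset hclosed ?_
  rintro _ ⟨Ξ, hΞ, rfl⟩
  exact ⟨(hF Ξ hΞ).choi_posSemidef, trace_choi (hF Ξ hΞ)⟩

theorem exists_psucc_eq_bestSucc {F : Set (SuperOp n m)} (hF : ∀ Ξ ∈ F, IsChannel Ξ)
    (hne : F.Nonempty) (hclosed : IsClosedSet F) {N : ℕ} (E : Ensemble N (n × n))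
    (M : Measurement N (n × m)) :
    ∃ Ξ ∈ F, ENNReal.ofReal (psucc Ξ E M) = bestSucc F E M := by
  obtain ⟨_, ⟨Ξ, hΞ, rfl⟩, hmax⟩ := (isCompact_image_choi hF hclosed).exists_isMaxOn
    (hne.image choi) (continuous_psuccChoi E M).continuousOn
  refine ⟨Ξ, hΞ, le_antisymm
    (le_iSup₂ (f := fun Ξ _ => ENNReal.ofReal (psucc Ξ E M)) Ξ hΞ)
    (iSup₂_le fun Θ hΘ => ENNReal.ofReal_le_ofReal ?_)⟩
  rw [psucc_eq_psuccChoi, psucc_eq_psuccChoi]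
  exact hmax ⟨Θ, hΘ, rfl⟩

omit [DecidableEq m] in
/-- The feasible set is the projection, along the compact set of free Choi operators, of a closed
set. -/
theorem isClosed_setOf_isFeasible {F : Set (SuperOp n m)} (hF : ∀ Ξ ∈ F, IsChannel Ξ)
    (hclosed : IsClosedSet F) {Λ : SuperOp n m} (hΛ : IsChannel Λ) :
    IsClosed {s : ℝ≥0 | IsFeasible F Λ s} := by
  have hK := isCompact_image_choi hF hclosed
  have : CompactSpace (choi '' F) := isCompact_iff_compactSpace.1 hK
  have hcl : IsClosed {p : ℝ≥0 × (choi '' F) |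
      ((1 + (p.1 : ℝ)) • (p.2 : Matrix (n × m) (n × m) ℂ) - choi Λ).PosSemidef} :=
    isClosed_setOf_posSemidef.preimage
      (f := fun p : ℝ≥0 × (choi '' F) =>
        (1 + (p.1 : ℝ)) • (p.2 : Matrix (n × m) (n × m) ℂ) - choi Λ) (by fun_prop)
  convert isClosedMap_fst_of_compactSpace _ hcl using 1
  ext s
  simp [isFeasible_iff hF hΛ]

omit [DecidableEq m] in
theorem exists_isFeasible_robustness_eq {F : Set (SuperOp n m)} (hF : ∀ Ξ ∈ F, IsChannel Ξ)
    (hclosed : IsClosedSet F) {Λ : SuperOp n m} (hΛ : IsChannel Λ) (htop : robustness F Λ ≠ ⊤) :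
    ∃ s : ℝ≥0, IsFeasible F Λ s ∧ robustness F Λ = s := by
  have hne : {s : ℝ≥0 | IsFeasible F Λ s}.Nonempty := by
    by_contra! h
    refine htop ?_
    simp only [robustness, iInf_eq_top]
    exact fun s hs => absurd (show s ∈ {s : ℝ≥0 | IsFeasible F Λ s} from hs) (by simp [h])
  refine ⟨sInf {s : ℝ≥0 | IsFeasible F Λ s},
    (isClosed_setOf_isFeasible hF hclosed hΛ).csInf_mem hne (OrderBot.bddBelow _), ?_⟩
  rw [ENNReal.coe_sInf hne]
  rfl

end Duality

end ChannelQRT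

end

/-- The first conjunct is the equality; the others say that the maxima and the minimum that occur
in it are attained (the last two when the free sets are closed). -/
theorem mainTheorem7 {n m ι : Type*} [Fintype n] [DecidableEq n] [Nonempty n]
    [Fintype m] [DecidableEq m]
    (F : ι → Set (ChannelQRT.SuperOp n m))
    (hchannel : ∀ k, ∀ Ξ ∈ F k, ChannelQRT.IsChannel Ξ)
    (hconvex : ∀ k, Convex ℝ (F k))
    (Λ : ChannelQRT.SuperOp n m) (hΛ : ChannelQRT.IsChannel Λ) :
    (⨅ k, ChannelQRT.maxAdvantage Λ (F k)) = 1 + ChannelQRT.robustness (⋃ k, F k) Λ ∧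
    (∀ k, ∃ (N : ℕ) (E : ChannelQRT.Ensemble N (n × n)) (M : ChannelQRT.Measurement N (n × m)),
      ChannelQRT.advantage Λ (F k) E M = ChannelQRT.maxAdvantage Λ (F k)) ∧
    (∀ k, (F k).Nonempty → ChannelQRT.IsClosedSet (F k) →
      ∀ (N : ℕ) (E : ChannelQRT.Ensemble N (n × n)) (M : ChannelQRT.Measurement N (n × m)),
        ∃ Ξ ∈ F k, ENNReal.ofReal (ChannelQRT.psucc Ξ E M) = ChannelQRT.bestSucc (F k) E M) ∧
    (ChannelQRT.IsClosedSet (⋃ k, F k) → ChannelQRT.robustness (⋃ k, F k) Λ ≠ ⊤ →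
      ∃ s : NNReal, ChannelQRT.IsFeasible (⋃ k, F k) Λ s ∧
        ChannelQRT.robustness (⋃ k, F k) Λ = (s : ENNReal)) := by
  have hU : ∀ Ξ ∈ ⋃ k, F k, ChannelQRT.IsChannel Ξ := by
    intro Ξ hΞ
    obtain ⟨k, hk⟩ := Set.mem_iUnion.1 hΞ
    exact hchannel k Ξ hk
  refine ⟨?_, fun k => (ChannelQRT.exists_advantage_eq (hchannel k) (hconvex k) hΛ).2,
    fun k hne hcl N E M => ChannelQRT.exists_psucc_eq_bestSucc (hchannel k) hne hcl E M,
    fun hcl htop => ChannelQRT.exists_isFeasible_robustness_eq hU hcl hΛ htop⟩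
  rw [ChannelQRT.robustness_iUnion, ENNReal.add_iInf]
  exact iInf_congr fun k => (ChannelQRT.exists_advantage_eq (hchannel k) (hconvex k) hΛ).1
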